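/- Consider $J\ge 1$ items with order-up-to levels $Q_j\in\mathbb Z$, $Q_j>0$, independent Poisson demands of rates $\lambda_j>0$, unit stockout costs $b_j\ge 0$, a fixed replenishment cost $A$ and a lead time $\tau\ge 0$. Put $\Lambda=\sum_j\lambda_j$, $p_j=\lambda_j/\Lambda$, and let $D_j$ be Poisson with mean $\lambda_j\tau$. The state space is $\mathcal S=\{\boldsymbol i\in\mathbb Z^J: i_j\le Q_j\ \forall j\}$, $\boldsymbol i^{-j}$ is $\boldsymbol i$ with $i_j$ lowered by one, and the expected cost of stopping in $\boldsymbol i$ is $G(\boldsymbol i)=A+\sum_j b_j\sum_{r\ge i_j}(r-i_j)P(D_j=r)$. A trigger set $\mathcal U\subset\mathcal S$ defines a Markov chain $(\boldsymbol i^k)_{k\ge 0}$ with $\boldsymbol i^0=\boldsymbol Q$: from $\boldsymbol i\notin\mathcal U$ it moves to $\boldsymbol i^{-j}$ with probability $p_j$, from $\boldsymbol i\in\mathcal U$ it moves to $\boldsymbol Q$. A visit to $\boldsymbol i\in\mathcal U$ costs $G(\boldsymbol i)$ and lasts $\tau$; a visit to $\boldsymbol i\notin\mathcal U$ costs nothing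 and lasts $1/\Lambda$ on average. Call $\mathcal U$ admissible if $\boldsymbol Q\notin\mathcal U$ and the expected number of steps from $\boldsymbol Q$ to $\mathcal U$ is finite. The long-run expected average cost per unit time of $\mathcal U$ is $$\alpha_{\mathcal U}=\limsup_{m\to\infty}\frac{\sum_{k<m}E[\text{cost of the visit to }\boldsymbol i^k]}{\sum_{k<m}E[\text{duration of the visit to }\boldsymbol i^k]},$$ and $\alpha^*$ is the infimum of $\alpha_{\mathcal U}$ over admissible $\mathcal U$; an admissible $\mathcal U$ is optimal if it minimizes $\alpha_{\mathcal U}$ among the admissible sets. With $F(\boldsymbol i)=-G(\boldsymbol i)+\alpha^*\tau$ and $f(\boldsymbol i)=-\alpha^*/\Lambda$, the entrance fee is $f'(\boldsymbol i)=f(\boldsymbol i)-\bigl[\sum_j p_jF(\boldsymbol i^{-j})-F(\boldsymbol i)\bigr]$. Assume $\sum_j b_jQ_jP(D_j\ge Q_j+1)\le A<\sum_j b_jQ_j$. Then the trigger set control policy with stopping set $\mathcal U^*=\{\boldsymbol i\in\mathcal S: f'(\boldsymbol i)>0\}$ and continue set $\overline{\mathcal U}^*=\{\boldsymbol i\in\mathcal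 S: f'(\boldsymbol i)\le 0\}$ is optimal, and for it the limit defining the average cost exists and equals $\alpha^*$. Moreover, if $\mathcal U$ is any optimal trigger set and $\boldsymbol i$ is a state that its chain visits with positive probability, then $\boldsymbol i\notin\mathcal U$ whenever $f'(\boldsymbol i)<0$ and $\boldsymbol i\in\mathcal U$ whenever $f'(\boldsymbol i)>0$. -/

import Mathlib

open Filter Topology ProbabilityTheory
open scoped ENNReal

noncomputable section

/-- Data of the replenishment problem with `J` items: order-up-to levels `Q j`, Poisson demand
rates `rate j`, unit stockout costs `b j`, fixed replenishment cost `A`, lead time `τ`. -/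
structure VendingModel (J : ℕ) where
  Q : Fin J → ℤ
  rate : Fin J → ℝ
  b : Fin J → ℝ
  A : ℝ
  τ : ℝ
  Q_pos : ∀ j, 0 < Q j
  rate_pos : ∀ j, 0 < rate j
  b_nonneg : ∀ j, 0 ≤ b j
  τ_nonneg : 0 ≤ τ

namespace VendingModel

variable {J : ℕ} (M : VendingModel J)

/-- The state space: integer inventory vectors (negative entries record stockouts) that do not
exceed the order-up-to levels. -/
def State : Type := {i : Fin J → ℤ // ∀ j, i j ≤ M.Q j}

/-- The full machine, the initial state of every replenishment cycle. -/
def full : M.State := ⟨M.Q, fun _ => le_rfl⟩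

/-- The state after one demand for item `j`. -/
def dec (i : M.State) (j : Fin J) : M.State :=
  ⟨Function.update i.1 j (i.1 j - 1), fun k => by
    by_cases h : k = j
    · subst h
      have := i.2 k
      simp only [Function.update_self]
      omega
    · simpa [Function.update_of_ne h] using i.2 k⟩

/-- Total demand rate. -/
def totalRate : ℝ := ∑ j, M.rate j

/-- Probability that a demand is for item `j`. -/
def p (j : Fin J) : ℝ := M.rate j / M.totalRate

/-- The law of the demand for item `j` during the lead time. -/
def leadDemand (j : Fin J) : MeasureTheory.Measure ℕ :=
  poissonMeasure (M.rate j * M.τ).toNNReal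

/-- Expected cost of stopping in state `i`: the fixed cost and the stockout costs of the cycle,
those already incurred and those expected during the lead time. -/
def stopCost (i : M.State) : ℝ :=
  M.A + ∑ j, M.b j * ∑' r : ℕ, max ((r : ℝ) - (i.1 j : ℝ)) 0 * (M.leadDemand j).real {r}

theorem sum_ofReal_p [NeZero J] : ∑ j, ENNReal.ofReal (M.p j) = 1 := by
  have hpos : 0 < M.totalRate :=
    Finset.sum_pos (fun j _ => M.rate_pos j) Finset.univ_nonempty
  simp only [p]
  rw [← ENNReal.ofReal_sum_of_nonneg (fun j _ => (div_pos (M.rate_pos j) hpos).le)]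
  rw [← Finset.sum_div]
  change ENNReal.ofReal (M.totalRate / M.totalRate) = 1
  rw [div_self hpos.ne', ENNReal.ofReal_one]

/-- The law of the item asked for by a demand. -/
def demand [NeZero J] : PMF (Fin J) :=
  PMF.ofFintype (fun j => ENNReal.ofReal (M.p j)) M.sum_ofReal_p

/-- Transition kernel of the uniformized chain under the trigger set `U`: a trigger state is
followed by the full state, any other state by the state after the next demand. -/
def step [NeZero J] (U : Set M.State) (i : M.State) : PMF M.State :=
  open Classical in if i ∈ U then PMF.pure M.full else M.demand.map (M.dec i)

/-- Law of the state after `k` transitions of the chain under `U`, started from the full state. -/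
def law [NeZero J] (U : Set M.State) : ℕ → PMF M.State
  | 0 => PMF.pure M.full
  | k + 1 => (law U k).bind (M.step U)

/-- Law after `k` demands of the chain that starts from the full state and is frozen when it
enters `U`. -/
def stopped [NeZero J] (U : Set M.State) : ℕ → PMF M.State
  | 0 => PMF.pure M.full
  | k + 1 => (stopped U k).bind fun i =>
      open Classical in if i ∈ U then PMF.pure i else M.demand.map (M.dec i)

/-- Expected number of demands until the trigger set is entered in a cycle,
`∑ k, P (U is not entered within the first k demands)`. -/
def expCycleSteps [NeZero J] (U : Set M.State) : ℝ≥0∞ :=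
  ∑' k : ℕ, ∑' i : M.State, Uᶜ.indicator (M.stopped U k) i

/-- Admissible trigger sets: no trigger when the machine is full, and the chain returns to the
full state in finite expected time (ergodicity). -/
def Admissible [NeZero J] (U : Set M.State) : Prop :=
  M.full ∉ U ∧ M.expCycleSteps U < ∞

/-- Expectation of `v` under `μ`; used for laws with finite support only. -/
def expect (μ : PMF M.State) (v : M.State → ℝ) : ℝ := ∑' i, (μ i).toReal * v i

/-- Cost incurred at a visit to state `i` under `U`. -/
def visitCost (U : Set M.State) (i : M.State) : ℝ :=
  open Classical in if i ∈ U then M.stopCost i else 0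

/-- Mean time spent at a visit to state `i` under `U`. -/
def visitTime (U : Set M.State) (i : M.State) : ℝ :=
  open Classical in if i ∈ U then M.τ else 1 / M.totalRate

/-- Expected cost per expected unit of time over the first `m` visited states. -/
def avgCostUpTo [NeZero J] (U : Set M.State) (m : ℕ) : ℝ :=
  (∑ k ∈ Finset.range m, M.expect (M.law U k) (M.visitCost U)) /
    (∑ k ∈ Finset.range m, M.expect (M.law U k) (M.visitTime U))

/-- Long-run expected average cost per unit time under `U`. -/
def avgCost [NeZero J] (U : Set M.State) : ℝ := limsup (M.avgCostUpTo U) atTop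

/-- `U` minimizes the long-run expected average cost among the admissible trigger sets. -/
def IsOptimal [NeZero J] (U : Set M.State) : Prop :=
  M.Admissible U ∧ ∀ V : Set M.State, M.Admissible V → M.avgCost U ≤ M.avgCost V

/-- The optimal long-run expected average cost `α*`. -/
def optCost [NeZero J] : ℝ := sInf (M.avgCost '' {U | M.Admissible U})

/-- Reward for stopping, `F(i) = -G(i) + α* τ`. -/
def stopReward [NeZero J] (i : M.State) : ℝ := -M.stopCost i + M.optCost * M.τ

/-- Cost of continuing one step, `f(i) = -α* / Λ`. -/
def contCost [NeZero J] (_i : M.State) : ℝ := -M.optCost * (1 / M.totalRate)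

/-- The entrance fee `f'(i) = f(i) - (∑ j, p_j F(i - e_j) - F(i))`. -/
def entranceFee [NeZero J] (i : M.State) : ℝ :=
  M.contCost i - (∑ j, M.p j * M.stopReward (M.dec i j) - M.stopReward i)

/-- The fixed cost from which on it is optimal not to trigger in the full state. -/
def minFixedCost : ℝ :=
  ∑ j, M.b j * (M.Q j : ℝ) * (M.leadDemand j).real {r : ℕ | M.Q j + 1 ≤ (r : ℤ)}

end VendingModel

end

/-! Let h = `stockoutRate`. By renewal reward, the average cost of an admissible U is the expected
cost of a cycle divided by its expected duration (`Admissible.tendsto_avgCostUpTo`). One demand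
raises the stopping cost G by h/Λ on average, so Dynkin's formula gives, for every α, cycle cost − α
· cycle time = G(Q) − ατ + (1/Λ) E ∑ (h − α), the sum running over the states before the entrance
into U (`Admissible.cycleCost_sub`). The entrance fee is (h − α*)/Λ, so {f' > 0} is the one-step
look-ahead set {h > α*}.

Poisson tails grow as stock falls, so h never decreases along a path and {h > α} is absorbing: a
monotone stopping problem. Stopping when h first exceeds α collects every negative term and no
positive one, and this holds separately for each position l in the cycle
(`cycleMean_sub_lookAhead`).

The lower bound on A yields h(Q) ≤ α*, hence Q is not in the look-ahead set. The upper bound yields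
α* < ∑ λ_j b_j, the value of h when nothing is in stock, so the set is reached in finite expected
time. It attains α* because nearly optimal sets have bounded cycle times (`avgCost_lookAhead`). For
an optimal U all the losses of the termwise comparison vanish, which fixes U on visited states up to
ties. -/

noncomputable section

/-! ### Tails and expected excess of a Poisson variable -/

section Poisson

open scoped NNReal

theorem HasSum.congr_apply {f g : ℕ → ℝ} {a : ℝ} (hg : HasSum g a) (h : ∀ r, f r = g r) :
    HasSum f a :=
  funext h ▸ hg

variable (m : ℝ≥0)

theorem poissonMeasure_real_succ (r : ℕ) :
    ((r + 1 : ℕ) : ℝ) * (poissonMeasure m).real {r + 1} = m * (poissonMeasure m).real {r} := by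
  rw [poissonMeasure_real_singleton, poissonMeasure_real_singleton, Nat.factorial_succ]
  have h1 : ((r + 1 : ℕ) : ℝ) ≠ 0 := by positivity
  have h2 : ((r.factorial : ℕ) : ℝ) ≠ 0 := by positivity
  push_cast at h1 ⊢
  field_simp
  ring

theorem hasSum_poissonMeasure_real : HasSum (fun r : ℕ => (poissonMeasure m).real {r}) 1 := by
  simpa only [poissonMeasure_real_singleton] using hasSum_one_poissonMeasure m

theorem hasSum_indicator_poissonMeasure_real (s : Set ℕ) :
    HasSum (s.indicator fun r : ℕ => (poissonMeasure m).real {r}) ((poissonMeasure m).real s) := by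
  have hi : MeasureTheory.Integrable (s.indicator (1 : ℕ → ℝ)) (poissonMeasure m) :=
    (MeasureTheory.integrable_const (1 : ℝ)).indicator (MeasurableSet.of_discrete (s := s))
  have h := hasSum_integral_poissonMeasure hi
  rw [MeasureTheory.integral_indicator_one (MeasurableSet.of_discrete (s := s))] at h
  refine HasSum.congr_apply h fun r => ?_
  by_cases hr : r ∈ s <;> simp [hr, poissonMeasure_real_singleton]

theorem hasSum_cast_mul_poissonMeasure_real :
    HasSum (fun r : ℕ => (r : ℝ) * (poissonMeasure m).real {r}) m := by
  rw [← hasSum_nat_add_iff' 1]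
  simp only [poissonMeasure_real_succ]
  simpa using (hasSum_poissonMeasure_real m).mul_left (m : ℝ)

/-- Probability that a Poisson variable is at least `x`. -/
def poissonTail (x : ℤ) : ℝ := (poissonMeasure m).real {r : ℕ | x ≤ (r : ℤ)}

theorem hasSum_poissonTail (x : ℤ) :
    HasSum ({r : ℕ | x ≤ (r : ℤ)}.indicator fun r : ℕ => (poissonMeasure m).real {r})
      (poissonTail m x) :=
  hasSum_indicator_poissonMeasure_real m _

/-- Expected excess over `x` of a Poisson variable. -/
def poissonLoss (x : ℤ) : ℝ :=
  ∑' r : ℕ, max ((r : ℝ) - (x : ℝ)) 0 * (poissonMeasure m).real {r}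

theorem hasSum_sub_mul_poissonMeasure_real (x : ℤ) :
    HasSum (fun r : ℕ => ((r : ℝ) - x) * (poissonMeasure m).real {r}) (m - x) := by
  simpa [sub_mul] using
    (hasSum_cast_mul_poissonMeasure_real m).sub ((hasSum_poissonMeasure_real m).mul_left (x : ℝ))

theorem hasSum_poissonLoss (x : ℤ) :
    HasSum (fun r : ℕ => max ((r : ℝ) - (x : ℝ)) 0 * (poissonMeasure m).real {r})
      (poissonLoss m x) := by
  refine Summable.hasSum ?_
  refine Summable.of_nonneg_of_le (fun r => by positivity) (fun r => ?_)
    ((hasSum_cast_mul_poissonMeasure_real m).add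
      ((hasSum_poissonMeasure_real m).mul_left |(x : ℝ)|)).summable
  rw [← add_mul]
  refine mul_le_mul_of_nonneg_right (max_le ?_ (by positivity)) MeasureTheory.measureReal_nonneg
  linarith [neg_abs_le (x : ℝ)]

theorem poissonTail_nonneg (x : ℤ) : 0 ≤ poissonTail m x := MeasureTheory.measureReal_nonneg

theorem poissonTail_antitone : Antitone (poissonTail m) := fun _ _ h =>
  MeasureTheory.measureReal_mono fun _ hr => h.trans hr

theorem poissonTail_of_nonpos {x : ℤ} (hx : x ≤ 0) : poissonTail m x = 1 := by
  have : {r : ℕ | x ≤ (r : ℤ)} = Set.univ := by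
    ext r
    simp only [Set.mem_ofPred_eq, Set.mem_univ, iff_true]
    omega
  rw [poissonTail, this, MeasureTheory.probReal_univ]

/-- Lowering the threshold by one raises (r − x)⁺ by the indicator of r ≥ x. This makes the one-step
increment of the stopping cost a tail probability. -/
theorem poissonLoss_pred (x : ℤ) : poissonLoss m (x - 1) = poissonLoss m x + poissonTail m x := by
  refine (hasSum_poissonLoss m (x - 1)).unique ?_
  refine HasSum.congr_apply ((hasSum_poissonLoss m x).add (hasSum_poissonTail m x)) fun r => ?_
  by_cases hr : x ≤ (r : ℤ)
  · have hr' : (x : ℝ) ≤ r := by exact_mod_cast hr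
    rw [Set.indicator_of_mem (by exact hr), max_eq_left (by push_cast; linarith),
      max_eq_left (by linarith)]
    push_cast
    ring
  · have hr' : (r : ℝ) ≤ x - 1 := by
      have : (r : ℤ) ≤ x - 1 := by omega
      exact_mod_cast this
    rw [Set.indicator_of_notMem (by exact hr), max_eq_right (by push_cast; linarith),
      max_eq_right (by linarith)]
    ring

theorem sub_le_poissonLoss (x : ℤ) : (m : ℝ) - x ≤ poissonLoss m x :=
  hasSum_le (fun _ => mul_le_mul_of_nonneg_right (le_max_left _ _) MeasureTheory.measureReal_nonneg)
    (hasSum_sub_mul_poissonMeasure_real m x) (hasSum_poissonLoss m x)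

theorem poissonLoss_nonneg (x : ℤ) : 0 ≤ poissonLoss m x :=
  (hasSum_poissonLoss m x).nonneg fun _ => by positivity

theorem poissonLoss_of_nonpos {x : ℤ} (hx : x ≤ 0) : poissonLoss m x = m - x := by
  refine (hasSum_poissonLoss m x).unique ?_
  refine HasSum.congr_apply (hasSum_sub_mul_poissonMeasure_real m x) fun r => ?_
  congr 1
  have hx' : (x : ℝ) ≤ 0 := by exact_mod_cast hx
  exact max_eq_left (by linarith [(Nat.cast_nonneg r : (0 : ℝ) ≤ r)])

theorem poissonLoss_le (x : ℤ) : poissonLoss m x ≤ m + |(x : ℝ)| := by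
  have h := (hasSum_cast_mul_poissonMeasure_real m).add
    ((hasSum_poissonMeasure_real m).mul_left |(x : ℝ)|)
  rw [mul_one] at h
  refine hasSum_le (fun r => ?_) (hasSum_poissonLoss m x) h
  rw [← add_mul]
  refine mul_le_mul_of_nonneg_right (max_le ?_ (by positivity)) MeasureTheory.measureReal_nonneg
  linarith [neg_abs_le (x : ℝ)]

/-- The Poisson recursion r P(D = r) = m P(D = r − 1) turns E[D; D ≥ x + 1] into m P(D ≥ x). This
form brings out `minFixedCost` in `stopCost_full`. -/
theorem poissonLoss_eq (x : ℤ) :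
    poissonLoss m x = m * poissonTail m x - x * poissonTail m (x + 1) := by
  refine (hasSum_poissonLoss m x).unique ?_
  have h1 : HasSum (fun r : ℕ => (r : ℝ) *
      ({r : ℕ | x + 1 ≤ (r : ℤ)}.indicator fun r : ℕ => (poissonMeasure m).real {r}) r)
      (m * poissonTail m x) := by
    rw [← hasSum_nat_add_iff' 1]
    simp only [Finset.sum_range_one, Nat.cast_zero, zero_mul, sub_zero]
    refine HasSum.congr_apply ((hasSum_poissonTail m x).mul_left (m : ℝ)) fun r => ?_
    by_cases hr : x ≤ (r : ℤ)
    · have hr' : r + 1 ∈ {r : ℕ | x + 1 ≤ (r : ℤ)} := by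
        change x + 1 ≤ ((r + 1 : ℕ) : ℤ)
        omega
      rw [Set.indicator_of_mem hr', Set.indicator_of_mem (by exact hr),
        poissonMeasure_real_succ]
    · have hr' : r + 1 ∉ {r : ℕ | x + 1 ≤ (r : ℤ)} := by
        change ¬ x + 1 ≤ ((r + 1 : ℕ) : ℤ)
        omega
      rw [Set.indicator_of_notMem hr', Set.indicator_of_notMem (by exact hr)]
      simp
  refine HasSum.congr_apply (h1.sub ((hasSum_poissonTail m (x + 1)).mul_left (x : ℝ)))
    fun r => ?_
  by_cases hr : x + 1 ≤ (r : ℤ)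
  · have hr' : (x : ℝ) + 1 ≤ r := by exact_mod_cast hr
    rw [Set.indicator_of_mem (by exact hr), max_eq_left (by linarith)]
    ring
  · have hr' : (r : ℝ) ≤ x := by
      have : (r : ℤ) ≤ x := by omega
      exact_mod_cast this
    rw [Set.indicator_of_notMem (by exact hr), max_eq_right (by linarith)]
    ring

end Poisson

/-! ### Real-variable lemmas for the renewal argument -/

section Renewal

/-- The block from n/2 to n contains at least n/2 terms, each at least `a n`, and its sum tends to
0. It disposes of boundary terms of linear growth in Dynkin's formula. -/
theorem tendsto_mul_of_antitone_summable {a : ℕ → ℝ} (ha : Antitone a) (hs : Summable a) :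
    Tendsto (fun n : ℕ => (n : ℝ) * a n) atTop (𝓝 0) := by
  have h0 : ∀ n, 0 ≤ a n := fun n => ha.le_of_tendsto hs.tendsto_atTop_zero n
  have hlim := hs.hasSum.tendsto_sum_nat
  have hhalf : Tendsto (fun n : ℕ => n / 2) atTop atTop := Nat.tendsto_div_const_atTop (by norm_num)
  have hd : Tendsto (fun n : ℕ => 2 * (∑ k ∈ Finset.range n, a k -
      ∑ k ∈ Finset.range (n / 2), a k)) atTop (𝓝 0) := by
    simpa using (hlim.sub (hlim.comp hhalf)).const_mul 2
  refine squeeze_zero (fun n => mul_nonneg n.cast_nonneg (h0 n)) (fun n => ?_) hd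
  rw [← Finset.sum_Ico_eq_sub _ (Nat.div_le_self n 2)]
  have h1 : ((Finset.Ico (n / 2) n).card : ℝ) * a n ≤ ∑ k ∈ Finset.Ico (n / 2) n, a k := by
    rw [← nsmul_eq_mul]
    exact Finset.card_nsmul_le_sum _ _ _ fun k hk => ha (Finset.mem_Ico.1 hk).2.le
  rw [Nat.card_Ico] at h1
  have h2 : (n : ℝ) ≤ 2 * ((n - n / 2 : ℕ) : ℝ) := by
    have : n ≤ 2 * (n - n / 2) := by omega
    exact_mod_cast this
  nlinarith [h0 n]

/-- Weighted means with bounded weights of positive density have the limit of the sequence. -/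
theorem tendsto_weighted_mean {u x : ℕ → ℝ} {L l : ℝ} (hL : 0 < L) (h0 : ∀ n, 0 ≤ u n)
    (h1 : ∀ n, u n ≤ 1) (hu : ∀ m : ℕ, (m : ℝ) ≤ L * ∑ n ∈ Finset.range m, u n)
    (hx : Tendsto x atTop (𝓝 l)) :
    Tendsto (fun m : ℕ => (∑ n ∈ Finset.range m, u n * x (m - n)) / ∑ n ∈ Finset.range m, u n)
      atTop (𝓝 l) := by
  have hx' : Tendsto (fun n => |x (n + 1) - l|) atTop (𝓝 0) := by
    have := ((hx.comp (tendsto_add_atTop_nat 1)).sub_const l).abs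
    simpa using this
  have hc := (hx'.cesaro).const_mul L
  rw [mul_zero] at hc
  rw [tendsto_iff_norm_sub_tendsto_zero]
  refine squeeze_zero' (Eventually.of_forall fun _ => norm_nonneg _) ?_ hc
  filter_upwards [eventually_gt_atTop 0] with m hm
  have hm' : (0 : ℝ) < m := by exact_mod_cast hm
  have hS : 0 < ∑ n ∈ Finset.range m, u n := by
    by_contra h
    nlinarith [hu m]
  -- The weights are at most 1, so the error is at most an unweighted sum; the linear lower bound on
  -- the total weight then makes it a Cesàro mean.
  have hnum : |∑ n ∈ Finset.range m, u n * (x (m - n) - l)| ≤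
      ∑ n ∈ Finset.range m, |x (n + 1) - l| := by
    rw [← Finset.sum_range_reflect (fun n => |x (n + 1) - l|)]
    refine (Finset.abs_sum_le_sum_abs _ _).trans (Finset.sum_le_sum fun n hn => ?_)
    rw [abs_mul, abs_of_nonneg (h0 n)]
    have : m - 1 - n + 1 = m - n := by have := Finset.mem_range.1 hn; omega
    rw [this]
    exact mul_le_of_le_one_left (abs_nonneg _) (h1 n)
  have heq : (∑ n ∈ Finset.range m, u n * x (m - n)) / ∑ n ∈ Finset.range m, u n - l =
      (∑ n ∈ Finset.range m, u n * (x (m - n) - l)) / ∑ n ∈ Finset.range m, u n := by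
    rw [eq_div_iff hS.ne', sub_mul, div_mul_cancel₀ _ hS.ne', Finset.mul_sum,
      ← Finset.sum_sub_distrib]
    exact Finset.sum_congr rfl fun n _ => by ring
  rw [heq, Real.norm_eq_abs, abs_div, abs_of_pos hS, div_le_iff₀ hS]
  refine hnum.trans ?_
  have hnn : 0 ≤ ∑ n ∈ Finset.range m, |x (n + 1) - l| := Finset.sum_nonneg fun _ _ => abs_nonneg _
  calc ∑ n ∈ Finset.range m, |x (n + 1) - l|
      = (m : ℝ)⁻¹ * (∑ n ∈ Finset.range m, |x (n + 1) - l|) * m := by field_simp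
    _ ≤ (m : ℝ)⁻¹ * (∑ n ∈ Finset.range m, |x (n + 1) - l|) *
        (L * ∑ n ∈ Finset.range m, u n) := mul_le_mul_of_nonneg_left (hu m) (by positivity)
    _ = _ := by ring

/-- Regrouping by the start n of a cycle: before time m, that cycle contributes its first m − n
terms. -/
theorem sum_range_convolution (u y : ℕ → ℝ) (m : ℕ) :
    ∑ k ∈ Finset.range m, ∑ l ∈ Finset.range (k + 1), u (k - l) * y l =
      ∑ n ∈ Finset.range m, u n * ∑ l ∈ Finset.range (m - n), y l := by
  induction m with
  | zero => simp
  | succ m ih =>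
    rw [Finset.sum_range_succ, ih]
    have h : ∑ n ∈ Finset.range m, u n * ∑ l ∈ Finset.range (m + 1 - n), y l =
        ∑ n ∈ Finset.range m, u n * ∑ l ∈ Finset.range (m - n), y l +
          ∑ n ∈ Finset.range m, u n * y (m - n) := by
      rw [← Finset.sum_add_distrib]
      refine Finset.sum_congr rfl fun n hn => ?_
      have : m + 1 - n = m - n + 1 := by have := Finset.mem_range.1 hn; omega
      rw [this, Finset.sum_range_succ, mul_add]
    have h2 : ∑ l ∈ Finset.range (m + 1), u (m - l) * y l =
        ∑ n ∈ Finset.range (m + 1), u n * y (m - n) := by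
      rw [← Finset.sum_range_reflect]
      refine Finset.sum_congr rfl fun n hn => ?_
      have := Finset.mem_range.1 hn
      congr 2; omega
    rw [h2, Finset.sum_range_succ, Finset.sum_range_succ _ m, h]
    simp
    ring

end Renewal

/-! ### Expectations under finitely supported laws -/

section Mean

variable {α β : Type*}

/-- Expectation of a real function under a probability mass function. -/
def PMF.mean (μ : PMF α) (v : α → ℝ) : ℝ := ∑' a, (μ a).toReal * v a

theorem PMF.mean_eq_sum (μ : PMF α) (v : α → ℝ) {s : Finset α} (hs : μ.support ⊆ s) :
    μ.mean v = ∑ a ∈ s, (μ a).toReal * v a :=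
  tsum_eq_sum fun a ha => by
    have : μ a = 0 := by
      by_contra h
      exact ha (hs ((μ.mem_support_iff a).2 h))
    simp [this]

theorem PMF.mean_pure (a : α) (v : α → ℝ) : (PMF.pure a).mean v = v a := by
  rw [PMF.mean_eq_sum _ _ (s := {a}) (by simp)]
  simp

theorem PMF.mean_bind (μ : PMF α) (f : α → PMF β) (v : β → ℝ) (hμ : μ.support.Finite)
    (hf : ∀ a, (f a).support.Finite) :
    (μ.bind f).mean v = μ.mean fun a => (f a).mean v := by
  classical
  have hS : μ.support ⊆ (hμ.toFinset : Set α) := by simp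
  have hT : ∀ a ∈ hμ.toFinset, (f a).support ⊆
      ((hμ.toFinset.biUnion fun a => (hf a).toFinset : Finset β) : Set β) := by
    intro a ha b hb
    simp only [Finset.coe_biUnion, Set.mem_iUnion]
    exact ⟨a, ha, by simpa using hb⟩
  have hTb : (μ.bind f).support ⊆
      ((hμ.toFinset.biUnion fun a => (hf a).toFinset : Finset β) : Set β) := by
    intro b hb
    obtain ⟨a, ha, hab⟩ := (PMF.mem_support_bind_iff _ _ _).1 hb
    exact hT a (by simpa using ha) hab
  rw [PMF.mean_eq_sum _ _ hTb, PMF.mean_eq_sum _ _ hS]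
  have h1 : ∀ b, ((μ.bind f) b).toReal = ∑ a ∈ hμ.toFinset, (μ a).toReal * (f a b).toReal := by
    intro b
    rw [PMF.bind_apply, tsum_eq_sum (s := hμ.toFinset), ENNReal.toReal_sum]
    · simp [ENNReal.toReal_mul]
    · exact fun a _ => ENNReal.mul_ne_top (PMF.apply_ne_top _ _) (PMF.apply_ne_top _ _)
    · intro a ha
      have : μ a = 0 := by
        by_contra h
        exact ha (by simpa using h)
      simp [this]
  simp only [h1, Finset.sum_mul]
  rw [Finset.sum_comm]
  refine Finset.sum_congr rfl fun a ha => ?_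
  rw [PMF.mean_eq_sum _ _ (hT a ha), Finset.mul_sum]
  exact Finset.sum_congr rfl fun b _ => by ring

theorem PMF.mean_add {μ : PMF α} (hμ : μ.support.Finite) (v w : α → ℝ) :
    μ.mean (v + w) = μ.mean v + μ.mean w := by
  have hS : μ.support ⊆ (hμ.toFinset : Set α) := by simp
  simp only [PMF.mean_eq_sum _ _ hS, ← Finset.sum_add_distrib, Pi.add_apply, mul_add]

theorem PMF.mean_smul {μ : PMF α} (c : ℝ) (v : α → ℝ) :
    μ.mean (c • v) = c * μ.mean v := by
  simp only [PMF.mean, Pi.smul_apply, smul_eq_mul, ← tsum_mul_left]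
  exact tsum_congr fun a => by ring

theorem PMF.mean_one {μ : PMF α} : μ.mean 1 = 1 := by
  simp only [PMF.mean, Pi.one_apply, mul_one]
  rw [← ENNReal.tsum_toReal_eq (fun a => μ.apply_ne_top a), μ.tsum_coe, ENNReal.toReal_one]

theorem PMF.mean_nonneg {μ : PMF α} {v : α → ℝ} (h : 0 ≤ v) : 0 ≤ μ.mean v :=
  tsum_nonneg fun i => mul_nonneg ENNReal.toReal_nonneg (h i)

theorem PMF.support_bind_finite (μ : PMF α) (f : α → PMF β) (hμ : μ.support.Finite)
    (hf : ∀ a, (f a).support.Finite) : (μ.bind f).support.Finite := by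
  rw [PMF.support_bind]
  exact hμ.biUnion fun a _ => hf a

end Mean

/-! ### The chain killed on entering the trigger set, and renewal decomposition -/

namespace VendingModel

variable {J : ℕ} (M : VendingModel J)

theorem totalRate_pos [NeZero J] : 0 < M.totalRate :=
  Finset.sum_pos (fun j _ => M.rate_pos j) Finset.univ_nonempty

theorem p_pos [NeZero J] (j : Fin J) : 0 < M.p j := div_pos (M.rate_pos j) M.totalRate_pos

theorem p_nonneg (j : Fin J) : 0 ≤ M.p j :=
  div_nonneg (M.rate_pos j).le (Finset.sum_nonneg fun j _ => (M.rate_pos j).le)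

theorem sum_p [NeZero J] : ∑ j, M.p j = 1 := by
  simp only [p]
  rw [← Finset.sum_div]
  exact div_self M.totalRate_pos.ne'

/-- Expected value of `v` after the next demand, as long as `U` has not been entered. -/
def killedStep (U : Set M.State) : (M.State → ℝ) →ₗ[ℝ] (M.State → ℝ) where
  toFun v := Uᶜ.indicator fun i => ∑ j, M.p j * v (M.dec i j)
  map_add' v w := by
    ext i
    by_cases hi : i ∈ U <;> simp [hi, mul_add, Finset.sum_add_distrib]
  map_smul' c v := by
    ext i
    by_cases hi : i ∈ U <;> simp [hi, Finset.mul_sum, mul_left_comm]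

/-- Expected value of `v` at the `l`-th state of a cycle, on the event that this state is reached
before or at the entrance into `U`. -/
def cycleMean (U : Set M.State) (l : ℕ) (v : M.State → ℝ) : ℝ := (M.killedStep U ^ l) v M.full

variable {M} {U V : Set M.State} {v w : M.State → ℝ}

theorem killedStep_of_mem {i : M.State} (hi : i ∈ U) : M.killedStep U v i = 0 := by
  simp [killedStep, hi]

theorem killedStep_of_notMem {i : M.State} (hi : i ∉ U) :
    M.killedStep U v i = ∑ j, M.p j * v (M.dec i j) := by
  simp [killedStep, hi]

theorem killedStep_mono (hUV : V ⊆ U) (h0 : 0 ≤ w) (h : v ≤ w) :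
    M.killedStep U v ≤ M.killedStep V w := by
  intro i
  have h1 : 0 ≤ ∑ j, M.p j * w (M.dec i j) :=
    Finset.sum_nonneg fun j _ => mul_nonneg (M.p_nonneg j) (h0 _)
  have h2 : ∑ j, M.p j * v (M.dec i j) ≤ ∑ j, M.p j * w (M.dec i j) :=
    Finset.sum_le_sum fun j _ => mul_le_mul_of_nonneg_left (h _) (M.p_nonneg j)
  by_cases hi : i ∈ V
  · rw [killedStep_of_mem hi, killedStep_of_mem (hUV hi)]
  · rw [killedStep_of_notMem hi]
    by_cases hi' : i ∈ U
    · rw [killedStep_of_mem hi']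
      exact h1
    · rw [killedStep_of_notMem hi']
      exact h2

theorem killedStep_pow_nonneg (h0 : 0 ≤ v) (l : ℕ) : 0 ≤ (M.killedStep U ^ l) v := by
  induction l with
  | zero => simpa using h0
  | succ l ih =>
    rw [pow_succ']
    intro i
    by_cases hi : i ∈ U
    · simp [killedStep_of_mem hi]
    · rw [Module.End.mul_apply, killedStep_of_notMem hi]
      exact Finset.sum_nonneg fun j _ => mul_nonneg (M.p_nonneg j) (ih _)

theorem killedStep_pow_mono (hUV : V ⊆ U) (h0 : 0 ≤ w) (h : v ≤ w) (l : ℕ) :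
    (M.killedStep U ^ l) v ≤ (M.killedStep V ^ l) w := by
  induction l with
  | zero => simpa using h
  | succ l ih =>
    rw [pow_succ', pow_succ']
    exact killedStep_mono hUV (killedStep_pow_nonneg h0 l) ih

theorem cycleMean_nonneg (h0 : 0 ≤ v) (l : ℕ) : 0 ≤ M.cycleMean U l v :=
  killedStep_pow_nonneg h0 l _

theorem cycleMean_mono_of_subset (hUV : V ⊆ U) (h0 : 0 ≤ w) (h : v ≤ w) (l : ℕ) :
    M.cycleMean U l v ≤ M.cycleMean V l w :=
  killedStep_pow_mono hUV h0 h l _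

theorem cycleMean_add (l : ℕ) (v w : M.State → ℝ) :
    M.cycleMean U l (v + w) = M.cycleMean U l v + M.cycleMean U l w := by
  simp [cycleMean]

theorem cycleMean_sub (l : ℕ) (v w : M.State → ℝ) :
    M.cycleMean U l (v - w) = M.cycleMean U l v - M.cycleMean U l w := by
  simp [cycleMean]

theorem cycleMean_smul (l : ℕ) (c : ℝ) (v : M.State → ℝ) :
    M.cycleMean U l (c • v) = c * M.cycleMean U l v := by
  simp [cycleMean]

theorem cycleMean_mono (h : v ≤ w) (l : ℕ) : M.cycleMean U l v ≤ M.cycleMean U l w := by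
  rw [← sub_nonneg, ← cycleMean_sub]
  exact cycleMean_nonneg (sub_nonneg.2 h) l

theorem cycleMean_zero (v : M.State → ℝ) : M.cycleMean U 0 v = v M.full := by
  simp [cycleMean]

theorem cycleMean_succ (l : ℕ) (v : M.State → ℝ) :
    M.cycleMean U (l + 1) v = M.cycleMean U l (M.killedStep U v) := by
  simp [cycleMean, pow_succ]

theorem cycleMean_indicator_add (l : ℕ) (v : M.State → ℝ) :
    M.cycleMean U l (U.indicator v) + M.cycleMean U l (Uᶜ.indicator v) = M.cycleMean U l v := by
  rw [← cycleMean_add, Set.indicator_self_add_compl]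

theorem indicator_one_nonneg (s : Set M.State) : (0 : M.State → ℝ) ≤ s.indicator 1 :=
  Set.indicator_nonneg fun _ _ => zero_le_one

/-! ### Laws of the chain -/

variable [NeZero J]

theorem demand_mean (i : M.State) (v : M.State → ℝ) :
    (M.demand.map (M.dec i)).mean v = ∑ j, M.p j * v (M.dec i j) := by
  rw [← PMF.bind_pure_comp, PMF.mean_bind _ _ _ (Set.toFinite _) (fun j => by simp)]
  simp only [Function.comp_apply, PMF.mean_pure]
  rw [PMF.mean_eq_sum _ _ (s := Finset.univ) (by simp)]
  refine Finset.sum_congr rfl fun j _ => ?_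
  rw [demand, PMF.ofFintype_apply, ENNReal.toReal_ofReal (M.p_nonneg j)]

theorem demand_support_finite (i : M.State) : (M.demand.map (M.dec i)).support.Finite := by
  rw [PMF.support_map]
  exact (Set.toFinite _).image _

variable (U) in
theorem step_support_finite (i : M.State) : (M.step U i).support.Finite := by
  unfold step
  split_ifs
  · simp
  · exact demand_support_finite i

variable (U) in
theorem law_support_finite (k : ℕ) : (M.law U k).support.Finite := by
  induction k with
  | zero => simp [law]
  | succ k ih => exact PMF.support_bind_finite _ _ ih (step_support_finite U)

theorem law_zero_mean : (M.law U 0).mean v = v M.full := PMF.mean_pure _ _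

theorem law_succ_mean (k : ℕ) (v : M.State → ℝ) :
    (M.law U (k + 1)).mean v =
      (M.law U k).mean (U.indicator 1) * v M.full + (M.law U k).mean (M.killedStep U v) := by
  rw [law, PMF.mean_bind _ _ _ (law_support_finite U k) (step_support_finite U), mul_comm,
    ← PMF.mean_smul, ← PMF.mean_add (law_support_finite U k)]
  congr 1
  ext i
  unfold step
  by_cases hi : i ∈ U
  · simp [hi, PMF.mean_pure, killedStep_of_mem]
  · simp [hi, demand_mean, killedStep_of_notMem]

variable (M) in
/-- Probability that a cycle starts at time `k`. -/
def renewalProb (U : Set M.State) : ℕ → ℝ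
  | 0 => 1
  | k + 1 => (M.law U k).mean (U.indicator 1)

/-- The chain at time `k` is in the `l`-th state of the cycle that started at time `k - l`. -/
theorem law_mean_eq_sum (k : ℕ) (v : M.State → ℝ) :
    (M.law U k).mean v =
      ∑ l ∈ Finset.range (k + 1), M.renewalProb U (k - l) * M.cycleMean U l v := by
  induction k generalizing v with
  | zero => simp [law_zero_mean, renewalProb, cycleMean_zero]
  | succ k ih =>
    -- The term l = 0 is a cycle starting at time k + 1; in the others one killed step moves from
    -- position l to l + 1.
    rw [law_succ_mean, Finset.sum_range_succ', ih (M.killedStep U v), add_comm]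
    simp [cycleMean_zero, cycleMean_succ, renewalProb]

variable (U) in
theorem renewalProb_nonneg (k : ℕ) : 0 ≤ M.renewalProb U k := by
  cases k with
  | zero => exact zero_le_one
  | succ k => exact PMF.mean_nonneg (Set.indicator_nonneg fun _ _ => zero_le_one)

variable (U) in
theorem renewalProb_le_one (k : ℕ) : M.renewalProb U k ≤ 1 := by
  cases k with
  | zero => exact le_rfl
  | succ k =>
    have h := PMF.mean_add (law_support_finite U k) (U.indicator 1) (Uᶜ.indicator 1)
    rw [Set.indicator_self_add_compl, PMF.mean_one] at h
    have h2 : 0 ≤ (M.law U k).mean (Uᶜ.indicator 1) :=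
      PMF.mean_nonneg (Set.indicator_nonneg fun _ _ => zero_le_one)
    change (M.law U k).mean (U.indicator 1) ≤ 1
    linarith

variable (U) in
theorem stopped_support_finite (k : ℕ) : (M.stopped U k).support.Finite := by
  induction k with
  | zero => simp [stopped]
  | succ k ih =>
    refine PMF.support_bind_finite _ _ ih fun i => ?_
    split_ifs
    · simp
    · exact demand_support_finite i

/-- Freezing and killing differ only by the mass sitting in U, which the indicator removes. It
translates admissibility into summability of `cycleMean`. -/
theorem stopped_mean_indicator (k : ℕ) (v : M.State → ℝ) :
    (M.stopped U k).mean (Uᶜ.indicator v) = M.cycleMean U k (Uᶜ.indicator v) := by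
  induction k generalizing v with
  | zero => rw [cycleMean_zero]; exact PMF.mean_pure _ _
  | succ k ih =>
    have h : M.killedStep U (Uᶜ.indicator v) =
        Uᶜ.indicator (M.killedStep U (Uᶜ.indicator v)) := by
      ext i
      by_cases hi : i ∈ U <;> simp [hi, killedStep_of_mem]
    rw [cycleMean_succ, h, ← ih, stopped, PMF.mean_bind _ _ _ (stopped_support_finite U k)]
    · congr 1
      ext i
      by_cases hi : i ∈ U
      · simp [hi, PMF.mean_pure]
      · simp [hi, demand_mean, killedStep_of_notMem]
    · intro i
      split_ifs
      · simp
      · exact demand_support_finite i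

theorem expCycleSteps_eq :
    M.expCycleSteps U = ∑' k, ENNReal.ofReal (M.cycleMean U k (Uᶜ.indicator 1)) := by
  unfold expCycleSteps
  refine tsum_congr fun k => ?_
  rw [← stopped_mean_indicator, PMF.mean]
  have h : ∀ i, ((M.stopped U k) i).toReal * (Uᶜ.indicator 1 : M.State → ℝ) i =
      (Uᶜ.indicator (M.stopped U k) i).toReal := by
    intro i
    by_cases hi : i ∈ U <;> simp [hi]
  have hle : ∑' i, Uᶜ.indicator (M.stopped U k) i ≤ 1 := by
    rw [← (M.stopped U k).tsum_coe]
    exact ENNReal.tsum_le_tsum fun i => Set.indicator_le_self _ _ i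
  have hne : ∑' i, Uᶜ.indicator (M.stopped U k) i ≠ ∞ := ne_top_of_le_ne_top ENNReal.one_ne_top hle
  rw [tsum_congr h, ← ENNReal.tsum_toReal_eq (fun i => ENNReal.ne_top_of_tsum_ne_top hne i),
    ENNReal.ofReal_toReal hne]

theorem admissible_iff :
    M.Admissible U ↔ M.full ∉ U ∧ Summable fun k => M.cycleMean U k (Uᶜ.indicator 1) := by
  unfold Admissible
  rw [expCycleSteps_eq, lt_top_iff_ne_top]
  refine and_congr_right fun _ => ⟨fun h => ?_, fun h => h.tsum_ofReal_ne_top⟩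
  refine (ENNReal.summable_toReal h).congr fun k => ?_
  rw [ENNReal.toReal_ofReal (cycleMean_nonneg (indicator_one_nonneg _) k)]

theorem Admissible.summable (h : M.Admissible U) :
    Summable fun k => M.cycleMean U k (Uᶜ.indicator 1) := (admissible_iff.1 h).2

end VendingModel

/-! ### Dynkin's formula and renewal reward -/

namespace VendingModel

variable {J : ℕ} (M : VendingModel J)

/-- Number of demands since the machine was full. -/
def level (i : M.State) : ℝ := ∑ j, ((M.Q j : ℝ) - (i.1 j : ℝ))

/-- Expected change of `v` at the next demand. -/
def drift (v : M.State → ℝ) (i : M.State) : ℝ := ∑ j, M.p j * v (M.dec i j) - v i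

/-- Expected sum of `v` over the states of a cycle that precede the entrance into `U`. -/
def occupation (U : Set M.State) (v : M.State → ℝ) : ℝ :=
  ∑' l, M.cycleMean U l (Uᶜ.indicator v)

/-- Rate at which the expected stopping cost grows while the replenishment is delayed. -/
def stockoutRate (i : M.State) : ℝ :=
  ∑ j, M.rate j * M.b j * poissonTail (M.rate j * M.τ).toNNReal (i.1 j)

/-- Expected cost of a cycle. -/
def cycleCost (U : Set M.State) : ℝ :=
  M.stopCost M.full + M.occupation U M.stockoutRate / M.totalRate

/-- Expected duration of a cycle. -/
def cycleTime (U : Set M.State) : ℝ := M.τ + M.occupation U 1 / M.totalRate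

variable {M} {U V : Set M.State} {v w : M.State → ℝ}

theorem sub_le_level (i : M.State) (j : Fin J) : (M.Q j : ℝ) - (i.1 j : ℝ) ≤ M.level i :=
  Finset.single_le_sum (f := fun j => (M.Q j : ℝ) - (i.1 j : ℝ))
    (fun k _ => sub_nonneg.2 (by exact_mod_cast i.2 k)) (Finset.mem_univ j)

theorem level_nonneg (i : M.State) : 0 ≤ M.level i :=
  Finset.sum_nonneg fun k _ => sub_nonneg.2 (by exact_mod_cast i.2 k)

theorem sum_dec (i : M.State) (j : Fin J) (f : Fin J → ℤ → ℝ) :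
    ∑ k, f k ((M.dec i j).1 k) = ∑ k, f k (i.1 k) + (f j (i.1 j - 1) - f j (i.1 j)) := by
  rw [← sub_eq_iff_eq_add', ← Finset.sum_sub_distrib, Finset.sum_eq_single j]
  · simp [dec]
  · intro k _ hk
    simp [dec, Function.update_of_ne hk]
  · simp

theorem level_dec (i : M.State) (j : Fin J) : M.level (M.dec i j) = M.level i + 1 := by
  unfold level
  rw [sum_dec i j fun k x => (M.Q k : ℝ) - (x : ℝ)]
  push_cast
  ring

theorem abs_cycleMean_le (h : ∀ i, |v i| ≤ w i) (l : ℕ) :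
    |M.cycleMean U l v| ≤ M.cycleMean U l w := by
  have h1 := cycleMean_mono (U := U) (v := v) (w := w) (fun i => (le_abs_self _).trans (h i)) l
  have h2 := cycleMean_mono (U := U) (v := (-1 : ℝ) • v) (w := w)
    (fun i => by simpa using (neg_le_abs _).trans (h i)) l
  rw [cycleMean_smul] at h2
  exact abs_le.2 ⟨by linarith, h1⟩

theorem killedStep_eq_indicator (v : M.State → ℝ) :
    M.killedStep U v = Uᶜ.indicator v + Uᶜ.indicator (M.drift v) := by
  ext i
  by_cases hi : i ∈ U
  · simp [hi, killedStep_of_mem]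
  · simp [hi, killedStep_of_notMem, drift]

theorem cycleMean_indicator_eq (l : ℕ) (v : M.State → ℝ) :
    M.cycleMean U l (U.indicator v) = M.cycleMean U l v - M.cycleMean U (l + 1) v +
      M.cycleMean U l (Uᶜ.indicator (M.drift v)) := by
  rw [cycleMean_succ, killedStep_eq_indicator, cycleMean_add, ← cycleMean_indicator_add l v]
  ring

/-- Dynkin's formula at a finite horizon, by telescoping; `cycleMean U m v` is the boundary term
still to be shown negligible. -/
theorem sum_cycleMean_indicator (m : ℕ) (v : M.State → ℝ) :
    ∑ l ∈ Finset.range m, M.cycleMean U l (U.indicator v) = v M.full - M.cycleMean U m v +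
      ∑ l ∈ Finset.range m, M.cycleMean U l (Uᶜ.indicator (M.drift v)) := by
  simp only [cycleMean_indicator_eq, Finset.sum_add_distrib]
  rw [Finset.sum_range_sub', cycleMean_zero]

/-- Each demand raises the level by exactly one, so after l surviving steps the level is
deterministic. -/
theorem killedStep_pow_level (l : ℕ) (i : M.State) :
    (M.killedStep U ^ l) M.level i = (M.level i + l) * (M.killedStep U ^ l) 1 i := by
  induction l generalizing i with
  | zero => simp
  | succ l ih =>
    rw [pow_succ', Module.End.mul_apply, Module.End.mul_apply]
    by_cases hi : i ∈ U
    · simp [killedStep_of_mem hi]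
    · rw [killedStep_of_notMem hi, killedStep_of_notMem hi, Finset.mul_sum]
      refine Finset.sum_congr rfl fun j _ => ?_
      rw [ih, level_dec]
      push_cast
      ring

theorem cycleMean_level (l : ℕ) : M.cycleMean U l M.level = l * M.cycleMean U l 1 := by
  rw [cycleMean, killedStep_pow_level]
  simp [level, full, cycleMean]

/-! ### Stopping costs -/

variable (M) in
/-- Stockout cost rate when every item is out of stock. -/
def maxRate : ℝ := ∑ j, M.rate j * M.b j

theorem rate_mul_τ_nonneg (j : Fin J) : 0 ≤ M.rate j * M.τ :=
  mul_nonneg (M.rate_pos j).le M.τ_nonneg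

theorem stopCost_eq (i : M.State) :
    M.stopCost i = M.A + ∑ j, M.b j * poissonLoss (M.rate j * M.τ).toNNReal (i.1 j) := rfl

theorem stopCost_dec (i : M.State) (j : Fin J) :
    M.stopCost (M.dec i j) =
      M.stopCost i + M.b j * poissonTail (M.rate j * M.τ).toNNReal (i.1 j) := by
  rw [stopCost_eq, stopCost_eq,
    sum_dec i j fun k x => M.b k * poissonLoss (M.rate k * M.τ).toNNReal x, poissonLoss_pred]
  ring

theorem stockoutRate_nonneg (i : M.State) : 0 ≤ M.stockoutRate i :=
  Finset.sum_nonneg fun j _ =>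
    mul_nonneg (mul_nonneg (M.rate_pos j).le (M.b_nonneg j)) (poissonTail_nonneg _ _)

theorem stockoutRate_le (i : M.State) : M.stockoutRate i ≤ M.maxRate :=
  Finset.sum_le_sum fun j _ => mul_le_of_le_one_right
    (mul_nonneg (M.rate_pos j).le (M.b_nonneg j)) MeasureTheory.measureReal_le_one

/-- The monotonicity that makes the look-ahead sets absorbing. -/
theorem stockoutRate_le_dec (i : M.State) (j : Fin J) :
    M.stockoutRate i ≤ M.stockoutRate (M.dec i j) := by
  unfold stockoutRate
  rw [sum_dec i j fun k x => M.rate k * M.b k * poissonTail (M.rate k * M.τ).toNNReal x]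
  have h := mul_le_mul_of_nonneg_left
    (poissonTail_antitone (M.rate j * M.τ).toNNReal (sub_le_self (i.1 j) zero_le_one))
    (mul_nonneg (M.rate_pos j).le (M.b_nonneg j))
  linarith

theorem stockoutRate_full_le (i : M.State) : M.stockoutRate M.full ≤ M.stockoutRate i :=
  Finset.sum_le_sum fun j _ => mul_le_mul_of_nonneg_left (poissonTail_antitone _ (i.2 j))
    (mul_nonneg (M.rate_pos j).le (M.b_nonneg j))

theorem abs_stockoutRate_le (i : M.State) : |M.stockoutRate i| ≤ M.maxRate := by
  rw [abs_of_nonneg (stockoutRate_nonneg i)]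
  exact stockoutRate_le i

theorem abs_inventory_le (i : M.State) (j : Fin J) :
    |(i.1 j : ℝ)| ≤ M.Q j + M.level i := by
  have h1 := sub_le_level i j
  have h2 : (i.1 j : ℝ) ≤ M.Q j := by exact_mod_cast i.2 j
  have h3 : (0 : ℝ) < M.Q j := by exact_mod_cast M.Q_pos j
  have h4 := level_nonneg i
  exact abs_le.2 ⟨by linarith, by linarith⟩

theorem abs_stopCost_le (i : M.State) :
    |M.stopCost i| ≤ (|M.A| + ∑ j, M.b j * (M.rate j * M.τ + M.Q j)) +
      (∑ j, M.b j) * M.level i := by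
  rw [stopCost_eq, add_assoc, Finset.sum_mul, ← Finset.sum_add_distrib]
  refine (abs_add_le _ _).trans (add_le_add_right ?_ _)
  rw [abs_of_nonneg (Finset.sum_nonneg fun j _ =>
    mul_nonneg (M.b_nonneg j) (poissonLoss_nonneg _ _))]
  refine Finset.sum_le_sum fun j _ => ?_
  rw [← mul_add]
  refine mul_le_mul_of_nonneg_left ?_ (M.b_nonneg j)
  have h := poissonLoss_le (M.rate j * M.τ).toNNReal (i.1 j)
  rw [Real.coe_toNNReal _ (rate_mul_τ_nonneg j)] at h
  linarith [abs_inventory_le i j]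

theorem expect_eq_mean (μ : PMF M.State) (v : M.State → ℝ) : M.expect μ v = μ.mean v := rfl

theorem occupation_smul (c : ℝ) (v : M.State → ℝ) :
    M.occupation U (c • v) = c * M.occupation U v := by
  unfold occupation
  rw [← tsum_mul_left]
  exact tsum_congr fun l => by
    rw [← cycleMean_smul]
    congr 1
    ext i
    by_cases hi : i ∈ U <;> simp [hi]

/-! ### Cycles -/

variable [NeZero J]

theorem drift_const (c : ℝ) : M.drift (fun _ => c) = 0 := by
  ext i
  simp [drift, ← Finset.sum_mul, M.sum_p]

theorem drift_one : M.drift 1 = 0 := drift_const 1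

theorem cycleMean_succ_one (l : ℕ) :
    M.cycleMean U (l + 1) 1 = M.cycleMean U l (Uᶜ.indicator 1) := by
  rw [cycleMean_succ, killedStep_eq_indicator, drift_one]
  simp

theorem antitone_cycleMean_one : Antitone fun l => M.cycleMean U l 1 :=
  antitone_nat_of_succ_le fun l => by
    rw [cycleMean_succ_one]
    exact cycleMean_mono (Set.indicator_le_self' fun _ _ => zero_le_one) l

namespace Admissible

theorem summable_one (hU : M.Admissible U) : Summable fun l => M.cycleMean U l 1 := by
  rw [← summable_nat_add_iff 1]
  simpa only [cycleMean_succ_one] using hU.summable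

/-- At position l the level is l, so the bound is (c + c'l) times the probability of reaching
position l, which is antitone and summable in l. -/
theorem tendsto_cycleMean (hU : M.Admissible U) {c c' : ℝ} (h : ∀ i, |v i| ≤ c + c' * M.level i) :
    Tendsto (fun l => M.cycleMean U l v) atTop (𝓝 0) := by
  have h1 : Tendsto (fun l : ℕ => c * M.cycleMean U l 1 + c' * (l * M.cycleMean U l 1)) atTop
      (𝓝 0) := by
    simpa using (hU.summable_one.tendsto_atTop_zero.const_mul c).add
      ((tendsto_mul_of_antitone_summable antitone_cycleMean_one hU.summable_one).const_mul c')
  refine squeeze_zero_norm (fun l => ?_) h1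
  have h2 := abs_cycleMean_le (U := U) (v := v) (w := c • (1 : M.State → ℝ) + c' • M.level)
    (fun i => by simpa using h i) l
  rwa [cycleMean_add, cycleMean_smul, cycleMean_smul, cycleMean_level] at h2

theorem summable_indicator (hU : M.Admissible U) {c : ℝ} (h : ∀ i, |v i| ≤ c) :
    Summable fun l => M.cycleMean U l (Uᶜ.indicator v) := by
  refine Summable.of_norm_bounded (hU.summable.mul_left c) fun l => ?_
  rw [← cycleMean_smul]
  refine abs_cycleMean_le (fun i => ?_) l
  by_cases hi : i ∈ U
  · simp [hi]
  · simpa [hi] using h i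

theorem occupation_add (hU : M.Admissible U) {c c' : ℝ}
    (hv : ∀ i, |v i| ≤ c) (hw : ∀ i, |w i| ≤ c') :
    M.occupation U (v + w) = M.occupation U v + M.occupation U w := by
  unfold occupation
  rw [← (hU.summable_indicator hv).tsum_add (hU.summable_indicator hw)]
  exact tsum_congr fun l => by rw [← cycleMean_add, Set.indicator_add']

theorem one_le_occupation_one (hU : M.Admissible U) : 1 ≤ M.occupation U 1 := by
  have h := hU.summable.sum_le_tsum {0}
    fun l _ => cycleMean_nonneg (indicator_one_nonneg Uᶜ) l
  simpa [cycleMean_zero, hU.1, occupation] using h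

theorem cycleTime_pos (hU : M.Admissible U) : 0 < M.cycleTime U :=
  add_pos_of_nonneg_of_pos M.τ_nonneg
    (div_pos (zero_lt_one.trans_le hU.one_le_occupation_one) M.totalRate_pos)

/-- Dynkin's formula for the value of `v` at the entrance into `U`. -/
theorem tendsto_sum_cycleMean (hU : M.Admissible U) {c c' d : ℝ}
    (h : ∀ i, |v i| ≤ c + c' * M.level i)
    (hd : ∀ i, |M.drift v i| ≤ d) :
    Tendsto (fun m => ∑ l ∈ Finset.range m, M.cycleMean U l (U.indicator v)) atTop
      (𝓝 (v M.full + M.occupation U (M.drift v))) := by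
  simp only [sum_cycleMean_indicator]
  simpa [occupation] using ((hU.tendsto_cycleMean h).const_sub (v M.full)).add
    (hU.summable_indicator hd).hasSum.tendsto_sum_nat

/-- The renewal reward theorem: long-run ratios of expectations are ratios of the
expectations over one cycle. -/
theorem tendsto_ratio (hU : M.Admissible U) {x y : ℝ}
    (hv : Tendsto (fun m => ∑ l ∈ Finset.range m, M.cycleMean U l v) atTop (𝓝 x))
    (hw : Tendsto (fun m => ∑ l ∈ Finset.range m, M.cycleMean U l w) atTop (𝓝 y)) (hy : y ≠ 0) :
    Tendsto (fun m => (∑ k ∈ Finset.range m, (M.law U k).mean v) /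
      ∑ k ∈ Finset.range m, (M.law U k).mean w) atTop (𝓝 (x / y)) := by
  have hpos : ∀ l, 0 ≤ M.cycleMean U l 1 := fun l => cycleMean_nonneg (fun _ => zero_le_one) l
  have hL : 0 < ∑' l, M.cycleMean U l 1 := by
    have h := hU.summable_one.sum_le_tsum {0} fun l _ => hpos l
    rw [Finset.sum_singleton, cycleMean_zero] at h
    exact zero_lt_one.trans_le h
  have hu : ∀ m : ℕ, (m : ℝ) ≤
      (∑' l, M.cycleMean U l 1) * ∑ n ∈ Finset.range m, M.renewalProb U n := by
    intro m
    -- Counting m visits cycle by cycle: each cycle contributes at most its expected number of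
    -- states, so cycles start with positive density.
    have h1 : (m : ℝ) = ∑ k ∈ Finset.range m, (M.law U k).mean 1 := by
      simp [PMF.mean_one]
    simp only [law_mean_eq_sum] at h1
    rw [sum_range_convolution] at h1
    rw [h1, Finset.mul_sum]
    refine Finset.sum_le_sum fun n _ => ?_
    rw [mul_comm]
    exact mul_le_mul_of_nonneg_right (hU.summable_one.sum_le_tsum _ fun l _ => hpos l)
      (renewalProb_nonneg U n)
  have hlim := (tendsto_weighted_mean hL (renewalProb_nonneg U) (renewalProb_le_one U) hu hv).div
    (tendsto_weighted_mean hL (renewalProb_nonneg U) (renewalProb_le_one U) hu hw) hy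
  refine hlim.congr' ?_
  filter_upwards [eventually_gt_atTop 0] with m hm
  have hm' : (0 : ℝ) < m := by exact_mod_cast hm
  have hS : ∑ n ∈ Finset.range m, M.renewalProb U n ≠ 0 := by
    intro h
    have := hu m
    rw [h, mul_zero] at this
    linarith
  simp only [law_mean_eq_sum, sum_range_convolution, Pi.div_apply]
  rw [div_div_div_cancel_right₀ hS]

end Admissible

theorem drift_stopCost (i : M.State) : M.drift M.stopCost i = M.stockoutRate i / M.totalRate := by
  simp only [drift, stopCost_dec, mul_add, Finset.sum_add_distrib, ← Finset.sum_mul, M.sum_p]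
  rw [stockoutRate, Finset.sum_div]
  simp only [p]
  rw [one_mul, add_sub_cancel_left]
  exact Finset.sum_congr rfl fun j _ => by ring

theorem abs_drift_stopCost_le (i : M.State) :
    |M.drift M.stopCost i| ≤ M.maxRate / M.totalRate := by
  rw [drift_stopCost, abs_div, abs_of_pos M.totalRate_pos]
  exact div_le_div_of_nonneg_right (abs_stockoutRate_le i) M.totalRate_pos.le

namespace Admissible

theorem tendsto_avgCostUpTo (hU : M.Admissible U) :
    Tendsto (M.avgCostUpTo U) atTop (𝓝 (M.cycleCost U / M.cycleTime U)) := by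
  have hc : M.visitCost U = U.indicator M.stopCost := by
    ext i
    by_cases hi : i ∈ U <;> simp [visitCost, hi]
  have ht : M.visitTime U =
      M.τ • U.indicator (1 : M.State → ℝ) + (1 / M.totalRate) • Uᶜ.indicator 1 := by
    ext i
    by_cases hi : i ∈ U <;> simp [visitTime, hi]
  unfold avgCostUpTo
  simp only [expect_eq_mean]
  refine hU.tendsto_ratio ?_ ?_ hU.cycleTime_pos.ne'
  · rw [hc]
    have h := hU.tendsto_sum_cycleMean abs_stopCost_le abs_drift_stopCost_le
    have hdr : M.drift M.stopCost = (1 / M.totalRate) • M.stockoutRate := by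
      ext i
      rw [drift_stopCost]
      simp [div_eq_inv_mul]
    rwa [hdr, occupation_smul, one_div_mul_eq_div] at h
  · rw [ht]
    -- Dynkin's formula for the constant 1: the entrance probabilities sum to 1, so τ is counted
    -- once per cycle.
    have h := hU.tendsto_sum_cycleMean (v := 1) (c := 1) (c' := 0) (d := 0) (by simp)
      (by simp [drift_one])
    have h0 : M.occupation U (M.drift 1) = 0 := by
      rw [drift_one, ← zero_smul ℝ (0 : M.State → ℝ), occupation_smul, zero_mul]
    rw [h0] at h
    have h2 := (h.const_mul M.τ).add (hU.summable.hasSum.tendsto_sum_nat.const_mul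
      (1 / M.totalRate))
    simp only [cycleMean_add, cycleMean_smul, Finset.sum_add_distrib, ← Finset.mul_sum]
    convert h2 using 2
    simp [cycleTime, occupation, div_eq_inv_mul]

theorem avgCost_eq (hU : M.Admissible U) : M.avgCost U = M.cycleCost U / M.cycleTime U :=
  hU.tendsto_avgCostUpTo.limsup_eq

end Admissible

end VendingModel

/-! ### The look-ahead rule, bounds on the optimal cost, and optimality -/

namespace VendingModel

variable {J : ℕ} (M : VendingModel J)

/-- The states in which no item is in stock. -/
def emptyStates : Set M.State := {i | ∀ j, i.1 j ≤ 0}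

/-- Expected value of the stock left over after the lead time, at the unit stockout costs. -/
def leftover (i : M.State) : ℝ :=
  ∑ j, M.b j * (poissonLoss (M.rate j * M.τ).toNNReal (i.1 j) - (M.rate j * M.τ - i.1 j))

variable {M} {U V : Set M.State} {v w : M.State → ℝ}

theorem leftover_nonneg (i : M.State) : 0 ≤ M.leftover i :=
  Finset.sum_nonneg fun j _ => mul_nonneg (M.b_nonneg j) <| by
    have h := sub_le_poissonLoss (M.rate j * M.τ).toNNReal (i.1 j)
    rw [Real.coe_toNNReal _ (rate_mul_τ_nonneg j)] at h
    exact sub_nonneg.2 h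

theorem leftover_of_mem {i : M.State} (hi : i ∈ M.emptyStates) : M.leftover i = 0 :=
  Finset.sum_eq_zero fun j _ => by
    rw [poissonLoss_of_nonpos _ (hi j), Real.coe_toNNReal _ (rate_mul_τ_nonneg j), sub_self,
      mul_zero]

theorem leftover_dec (i : M.State) (j : Fin J) : M.leftover (M.dec i j) =
    M.leftover i + M.b j * (poissonTail (M.rate j * M.τ).toNNReal (i.1 j) - 1) := by
  unfold leftover
  rw [sum_dec i j fun k x => M.b k * (poissonLoss (M.rate k * M.τ).toNNReal x -
    (M.rate k * M.τ - x)), poissonLoss_pred]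
  push_cast
  ring

theorem leftover_full : M.leftover M.full =
    M.stopCost M.full - M.A - M.maxRate * M.τ + ∑ j, M.b j * (M.Q j : ℝ) := by
  rw [stopCost_eq, leftover, maxRate, Finset.sum_mul, add_sub_cancel_left,
    ← Finset.sum_sub_distrib, ← Finset.sum_add_distrib]
  exact Finset.sum_congr rfl fun j _ => by simp only [full]; ring

theorem abs_leftover_le (i : M.State) :
    |M.leftover i| ≤ ∑ j, M.b j * (2 * M.Q j) + (∑ j, 2 * M.b j) * M.level i := by
  rw [abs_of_nonneg (leftover_nonneg i), Finset.sum_mul, ← Finset.sum_add_distrib]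
  refine Finset.sum_le_sum fun j _ => ?_
  have h := poissonLoss_le (M.rate j * M.τ).toNNReal (i.1 j)
  rw [Real.coe_toNNReal _ (rate_mul_τ_nonneg j)] at h
  have h2 := abs_inventory_le i j
  have h3 := le_abs_self (i.1 j : ℝ)
  have h4 := mul_le_mul_of_nonneg_left (a := M.b j)
    (show poissonLoss (M.rate j * M.τ).toNNReal (i.1 j) - (M.rate j * M.τ - i.1 j) ≤
      2 * M.Q j + 2 * M.level i by linarith) (M.b_nonneg j)
  linarith

/-- With `minFixedCost ≤ A` this gives G(Q) ≥ τ h(Q), the starting point for h(Q) ≤ α*. -/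
theorem stopCost_full :
    M.stopCost M.full = M.A - M.minFixedCost + M.τ * M.stockoutRate M.full := by
  rw [stopCost_eq, minFixedCost, stockoutRate, Finset.mul_sum, sub_add, ← Finset.sum_sub_distrib,
    sub_eq_add_neg, ← Finset.sum_neg_distrib]
  congr 1
  refine Finset.sum_congr rfl fun j _ => ?_
  rw [poissonLoss_eq, Real.coe_toNNReal _ (rate_mul_τ_nonneg j)]
  simp only [full, poissonTail, leadDemand]
  ring

/-- Truncating a function that vanishes on an absorbing set outside of that set is harmless. -/
theorem killedStep_pow_eq_of_absorbing (hU : ∀ i ∈ U, ∀ j, M.dec i j ∈ U)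
    (hv : ∀ i ∈ U, v i = 0) (l : ℕ) :
    (M.killedStep U ^ l) v = (M.killedStep ∅ ^ l) v ∧
      ∀ i ∈ U, (M.killedStep ∅ ^ l) v i = 0 := by
  induction l with
  | zero => exact ⟨rfl, by simpa using hv⟩
  | succ l ih =>
    have h0 : ∀ i ∈ U, (M.killedStep ∅ ^ (l + 1)) v i = 0 := by
      intro i hi
      rw [pow_succ', Module.End.mul_apply, killedStep_of_notMem (Set.notMem_empty i)]
      exact Finset.sum_eq_zero fun j _ => by rw [ih.2 _ (hU i hi j), mul_zero]
    refine ⟨?_, h0⟩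
    ext i
    by_cases hi : i ∈ U
    · rw [h0 i hi, pow_succ', Module.End.mul_apply, killedStep_of_mem hi]
    · rw [pow_succ', pow_succ', Module.End.mul_apply, Module.End.mul_apply,
        killedStep_of_notMem hi, killedStep_of_notMem (Set.notMem_empty i), ih.1]

variable (M) in
/-- Excess of the stockout rate over `α`. -/
def excess (α : ℝ) (i : M.State) : ℝ := M.stockoutRate i - α

theorem abs_excess_le (α : ℝ) (i : M.State) : |M.excess α i| ≤ M.maxRate + |α| :=
  (abs_sub _ _).trans (add_le_add_left (abs_stockoutRate_le i) _)

variable (M) in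
/-- The one-step look-ahead stopping set. -/
def lookAhead (α : ℝ) : Set M.State := {i | 0 < M.excess α i}

theorem dec_mem_lookAhead {α : ℝ} {i : M.State} (hi : i ∈ M.lookAhead α) (j : Fin J) :
    M.dec i j ∈ M.lookAhead α :=
  lt_of_lt_of_le hi (sub_le_sub_right (stockoutRate_le_dec i j) α)

theorem excess_neg_part_nonneg (α : ℝ) : (0 : M.State → ℝ) ≤ fun i => max (-M.excess α i) 0 :=
  fun _ => le_max_right _ _

theorem excess_pos_part_nonneg (α : ℝ) : (0 : M.State → ℝ) ≤ fun i => max (M.excess α i) 0 :=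
  fun _ => le_max_right _ _

theorem cycleMean_pos {i : M.State} {l : ℕ}
    (hi : 0 < M.cycleMean U l (({i} : Set M.State).indicator 1)) (hv : 0 ≤ v) (hvi : 0 < v i) :
    0 < M.cycleMean U l v := by
  refine (mul_pos hvi hi).trans_le ?_
  rw [← cycleMean_smul]
  refine cycleMean_mono (fun j => ?_) l
  by_cases hj : j = i
  · subst hj
    simp
  · simpa [hj] using hv j

/-- The negative part of the excess vanishes on the absorbing look-ahead set, so killing there
changes nothing: the rule collects the negative part of the unkilled chain. -/
theorem cycleMean_lookAhead (α : ℝ) (l : ℕ) :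
    M.cycleMean (M.lookAhead α) l ((M.lookAhead α)ᶜ.indicator (M.excess α)) =
      -M.cycleMean ∅ l (fun i => max (-M.excess α i) 0) := by
  have h : (M.lookAhead α)ᶜ.indicator (M.excess α) =
      (-1 : ℝ) • fun i => max (-M.excess α i) 0 := by
    ext i
    by_cases hi : i ∈ M.lookAhead α
    · have : 0 < M.excess α i := hi
      simp [hi, this.le]
    · have : M.excess α i ≤ 0 := not_lt.1 hi
      simp [hi, this]
  have h2 := (killedStep_pow_eq_of_absorbing (U := M.lookAhead α)
    (v := fun i => max (-M.excess α i) 0) (fun i hi j => dec_mem_lookAhead hi j)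
    (fun i hi => max_eq_right (neg_nonpos.2 (le_of_lt hi))) l).1
  rw [h, cycleMean_smul, neg_one_mul, cycleMean, cycleMean, h2]

/-- The loss of `U` against the one-step look-ahead rule in the `l`-th state of a cycle: stopping
too late in states of positive excess and too early in states of negative excess. -/
theorem cycleMean_sub_lookAhead (α : ℝ) (l : ℕ) :
    M.cycleMean U l (Uᶜ.indicator (M.excess α)) -
        M.cycleMean (M.lookAhead α) l ((M.lookAhead α)ᶜ.indicator (M.excess α)) =
      M.cycleMean U l (Uᶜ.indicator fun i => max (M.excess α i) 0) +
        M.cycleMean U l (U.indicator fun i => max (-M.excess α i) 0) +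
        (M.cycleMean ∅ l (fun i => max (-M.excess α i) 0) -
          M.cycleMean U l (fun i => max (-M.excess α i) 0)) := by
  rw [cycleMean_lookAhead, ← cycleMean_indicator_add (U := U) l fun i => max (-M.excess α i) 0]
  have h : Uᶜ.indicator (M.excess α) = Uᶜ.indicator (fun i => max (M.excess α i) 0) -
      Uᶜ.indicator (fun i => max (-M.excess α i) 0) := by
    ext i
    by_cases hi : i ∈ U
    · simp [hi]
    · rcases le_total (M.excess α i) 0 with h | h <;> simp [hi, h]
  rw [h, cycleMean_sub]
  ring

theorem cycleMean_lookAhead_le (α : ℝ) (l : ℕ) :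
    M.cycleMean (M.lookAhead α) l ((M.lookAhead α)ᶜ.indicator (M.excess α)) ≤
      M.cycleMean U l (Uᶜ.indicator (M.excess α)) := by
  have h := cycleMean_sub_lookAhead (U := U) α l
  have h1 : 0 ≤ M.cycleMean U l (Uᶜ.indicator fun i => max (M.excess α i) 0) :=
    cycleMean_nonneg (Set.indicator_nonneg fun i _ => excess_pos_part_nonneg α i) l
  have h2 : 0 ≤ M.cycleMean U l (U.indicator fun i => max (-M.excess α i) 0) :=
    cycleMean_nonneg (Set.indicator_nonneg fun i _ => excess_neg_part_nonneg α i) l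
  have h3 := cycleMean_mono_of_subset (Set.empty_subset U) (excess_neg_part_nonneg α)
    (le_refl (fun i => max (-M.excess α i) 0)) l
  linarith

variable [NeZero J]

/-- `leftover` is the stopping cost plus a function linear in the stock, so Dynkin's formula for it
compares a cycle's cost with `maxRate` times its duration. Its nonnegativity makes that comparison a
lower bound. -/
theorem drift_leftover (i : M.State) :
    M.drift M.leftover i = (M.stockoutRate i - M.maxRate) / M.totalRate := by
  simp only [drift, leftover_dec, mul_add, Finset.sum_add_distrib, ← Finset.sum_mul, M.sum_p]
  rw [stockoutRate, maxRate, ← Finset.sum_sub_distrib, Finset.sum_div]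
  simp only [p]
  rw [one_mul, add_sub_cancel_left]
  exact Finset.sum_congr rfl fun j _ => by ring

theorem full_notMem_emptyStates : M.full ∉ M.emptyStates := fun h =>
  (M.Q_pos 0).not_ge (h 0)

/-- The function i_j⁺/p_j has drift −1 while item j is in stock and 0 afterwards, so Dynkin's
formula bounds the expected number of demands with item j in stock by Q_j/p_j. -/
theorem summable_cycleMean_inStock (j : Fin J) :
    Summable fun l => M.cycleMean ∅ l ({i : M.State | 0 < i.1 j}.indicator 1) := by
  have hp := M.p_pos j
  have hd : M.drift (fun i => max (i.1 j : ℝ) 0 / M.p j) =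
      (-1 : ℝ) • {i : M.State | 0 < i.1 j}.indicator (1 : M.State → ℝ) := by
    ext i
    have hk : ∀ k, M.p k * (max ((M.dec i k).1 j : ℝ) 0 / M.p j) =
        M.p k * (max (i.1 j : ℝ) 0 / M.p j) +
          if k = j then max ((i.1 j : ℝ) - 1) 0 - max (i.1 j : ℝ) 0 else 0 := by
      intro k
      by_cases h : k = j
      · subst h
        simp only [dec, Function.update_self, if_true]
        push_cast
        field_simp
        ring
      · simp [dec, Function.update_of_ne (Ne.symm h), h]
    simp only [drift, hk, Finset.sum_add_distrib, ← Finset.sum_mul, M.sum_p, one_mul,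
      Finset.sum_ite_eq', Finset.mem_univ, if_true, Pi.smul_apply, smul_eq_mul]
    by_cases hi : 0 < i.1 j
    · have hi' : (1 : ℝ) ≤ i.1 j := by exact_mod_cast hi
      rw [Set.indicator_of_mem (by exact hi), max_eq_left (by linarith), max_eq_left (by linarith)]
      simp
    · have hi' : (i.1 j : ℝ) ≤ 0 := by exact_mod_cast not_lt.1 hi
      rw [Set.indicator_of_notMem (by exact hi), max_eq_right (by linarith),
        max_eq_right (by linarith)]
      simp
  refine summable_of_sum_range_le (c := max (M.Q j : ℝ) 0 / M.p j)
    (fun l => cycleMean_nonneg (indicator_one_nonneg _) l) fun m => ?_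
  have h := sum_cycleMean_indicator (U := ∅) m (fun i : M.State => max (i.1 j : ℝ) 0 / M.p j)
  have h0 : 0 ≤ M.cycleMean ∅ m (fun i : M.State => max (i.1 j : ℝ) 0 / M.p j) :=
    cycleMean_nonneg (fun i => by positivity) m
  simp only [hd, Set.compl_empty, Set.indicator_univ, Set.indicator_empty, cycleMean_smul] at h
  rw [← Finset.mul_sum] at h
  have hz' : ∑ l ∈ Finset.range m, M.cycleMean ∅ l (fun _ : M.State => (0 : ℝ)) = 0 :=
    Finset.sum_eq_zero fun l _ => by
      change (M.killedStep ∅ ^ l) 0 M.full = 0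
      simp
  rw [hz'] at h
  have hf : max (M.full.1 j : ℝ) 0 / M.p j = max (M.Q j : ℝ) 0 / M.p j := rfl
  rw [hf] at h
  linarith

theorem admissible_of_emptyStates_subset (hU : M.emptyStates ⊆ U) (hfull : M.full ∉ U) :
    M.Admissible U := by
  refine admissible_iff.2 ⟨hfull, ?_⟩
  refine Summable.of_nonneg_of_le (fun l => cycleMean_nonneg (indicator_one_nonneg _) l)
    (fun l => ?_)
    -- Outside U some item is in stock, so the indicator of the complement is at most the sum of the
    -- in-stock indicators.
    (summable_sum fun j (_ : j ∈ Finset.univ) => summable_cycleMean_inStock (M := M) j)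
  have hs : ∑ j, M.cycleMean ∅ l ({i : M.State | 0 < i.1 j}.indicator 1) =
      M.cycleMean ∅ l (∑ j, {i : M.State | 0 < i.1 j}.indicator 1) := by
    simp [cycleMean]
  have hnn : ∀ (j : Fin J) (i : M.State),
      0 ≤ ({i : M.State | 0 < i.1 j}.indicator 1 : M.State → ℝ) i :=
    fun j i => indicator_one_nonneg _ i
  rw [hs]
  refine cycleMean_mono_of_subset (Set.empty_subset U) (Finset.sum_nonneg fun j _ => hnn j)
    (fun i => ?_) l
  rw [Finset.sum_apply]
  by_cases hi : i ∈ U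
  · simpa [hi] using Finset.sum_nonneg fun j _ => hnn j i
  · obtain ⟨j, hj⟩ : ∃ j, 0 < i.1 j := by
      by_contra h
      push Not at h
      exact hi (hU h)
    refine le_trans ?_ (Finset.single_le_sum (fun j _ => hnn j i) (Finset.mem_univ j))
    rw [Set.indicator_of_mem (show i ∈ {i : M.State | 0 < i.1 j} from hj)]
    simp [hi]

theorem admissible_emptyStates : M.Admissible M.emptyStates :=
  admissible_of_emptyStates_subset subset_rfl full_notMem_emptyStates

namespace Admissible

theorem occupation_excess (hU : M.Admissible U) (α : ℝ) :
    M.occupation U (M.excess α) = M.occupation U M.stockoutRate - α * M.occupation U 1 := by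
  have h : M.excess α = M.stockoutRate + (-α) • (1 : M.State → ℝ) := by
    ext i
    simp [excess, sub_eq_add_neg]
  rw [h, hU.occupation_add (c' := |α|) abs_stockoutRate_le (by simp), occupation_smul]
  ring

theorem cycleCost_sub (hU : M.Admissible U) (α : ℝ) :
    M.cycleCost U - α * M.cycleTime U =
      M.stopCost M.full - α * M.τ + M.occupation U (M.excess α) / M.totalRate := by
  rw [hU.occupation_excess, cycleCost, cycleTime]
  ring

theorem tendsto_leftover (hU : M.Admissible U) :
    Tendsto (fun m => ∑ l ∈ Finset.range m, M.cycleMean U l (U.indicator M.leftover)) atTop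
      (𝓝 (M.cycleCost U - M.maxRate * M.cycleTime U - (M.A - ∑ j, M.b j * (M.Q j : ℝ)))) := by
  have hdr : M.drift M.leftover = (1 / M.totalRate) • M.excess M.maxRate := by
    ext i
    rw [drift_leftover]
    simp [excess, div_eq_inv_mul]
  have hb : ∀ i, |M.drift M.leftover i| ≤ 1 / M.totalRate * (M.maxRate + |M.maxRate|) := by
    intro i
    rw [hdr, Pi.smul_apply, smul_eq_mul, abs_mul, abs_of_pos (one_div_pos.2 M.totalRate_pos)]
    exact mul_le_mul_of_nonneg_left (abs_excess_le _ i) (one_div_pos.2 M.totalRate_pos).le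
  have h := hU.tendsto_sum_cycleMean abs_leftover_le hb
  rw [hdr, occupation_smul, leftover_full] at h
  convert h using 2
  rw [hU.cycleCost_sub]
  ring

theorem le_cycleCost_sub (hU : M.Admissible U) :
    M.A - ∑ j, M.b j * (M.Q j : ℝ) ≤ M.cycleCost U - M.maxRate * M.cycleTime U :=
  sub_nonneg.1 <| ge_of_tendsto' hU.tendsto_leftover fun _ => Finset.sum_nonneg fun l _ =>
    cycleMean_nonneg (Set.indicator_nonneg fun i _ => leftover_nonneg i) l

theorem stockoutRate_full_le_avgCost (hU : M.Admissible U) (hmin : M.minFixedCost ≤ M.A) :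
    M.stockoutRate M.full ≤ M.avgCost U := by
  rw [hU.avgCost_eq, le_div_iff₀ hU.cycleTime_pos, ← sub_nonneg, hU.cycleCost_sub, stopCost_full]
  have h : 0 ≤ M.occupation U (M.excess (M.stockoutRate M.full)) :=
    tsum_nonneg fun l => cycleMean_nonneg
      (Set.indicator_nonneg fun i _ => sub_nonneg.2 (stockoutRate_full_le i)) l
  have h2 := div_nonneg h M.totalRate_pos.le
  linarith

end Admissible

/-- Nothing is left over in an empty state, so the bound `le_cycleCost_sub` is attained. When A < ∑
b_j Q_j this set has average cost below `maxRate`, hence so does the optimum. -/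
theorem cycleCost_emptyStates : M.cycleCost M.emptyStates -
    M.maxRate * M.cycleTime M.emptyStates = M.A - ∑ j, M.b j * (M.Q j : ℝ) := by
  have h0 : M.emptyStates.indicator M.leftover = (0 : ℝ) • (0 : M.State → ℝ) := by
    ext i
    by_cases hi : i ∈ M.emptyStates
    · simp [hi, leftover_of_mem]
    · simp [hi]
  have h := admissible_emptyStates.tendsto_leftover (M := M)
  simp only [h0, cycleMean_smul, zero_mul, Finset.sum_const_zero] at h
  exact (sub_eq_zero.1 (tendsto_nhds_unique h tendsto_const_nhds))

theorem bddBelow_avgCost (hmin : M.minFixedCost ≤ M.A) :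
    BddBelow (M.avgCost '' {U | M.Admissible U}) :=
  ⟨M.stockoutRate M.full, by
    rintro _ ⟨U, hU, rfl⟩
    exact Admissible.stockoutRate_full_le_avgCost hU hmin⟩

theorem optCost_le (hmin : M.minFixedCost ≤ M.A) (hU : M.Admissible U) :
    M.optCost ≤ M.avgCost U :=
  csInf_le (bddBelow_avgCost hmin) ⟨U, hU, rfl⟩

theorem stockoutRate_full_le_optCost (hmin : M.minFixedCost ≤ M.A) :
    M.stockoutRate M.full ≤ M.optCost :=
  le_csInf ⟨_, _, admissible_emptyStates, rfl⟩ <| by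
    rintro _ ⟨U, hU, rfl⟩
    exact Admissible.stockoutRate_full_le_avgCost hU hmin

theorem optCost_lt_maxRate (hmin : M.minFixedCost ≤ M.A)
    (hmax : M.A < ∑ j, M.b j * (M.Q j : ℝ)) : M.optCost < M.maxRate := by
  refine (optCost_le hmin admissible_emptyStates).trans_lt ?_
  rw [admissible_emptyStates.avgCost_eq, div_lt_iff₀ admissible_emptyStates.cycleTime_pos]
  linarith [cycleCost_emptyStates (M := M)]

theorem entranceFee_eq (i : M.State) :
    M.entranceFee i = M.excess M.optCost i / M.totalRate := by
  have h := drift_stopCost i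
  simp only [drift] at h
  have h2 : ∑ j, M.p j * (-M.stopCost (M.dec i j) + M.optCost * M.τ) =
      -∑ j, M.p j * M.stopCost (M.dec i j) + M.optCost * M.τ := by
    simp only [mul_add, Finset.sum_add_distrib, ← Finset.sum_mul, M.sum_p, mul_neg,
      Finset.sum_neg_distrib, one_mul]
  simp only [entranceFee, contCost, stopReward, h2, excess, sub_div]
  rw [← h]
  ring

theorem entranceFee_pos_iff (i : M.State) : 0 < M.entranceFee i ↔ 0 < M.excess M.optCost i := by
  rw [entranceFee_eq, div_pos_iff_of_pos_right M.totalRate_pos]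

theorem entranceFee_neg_iff (i : M.State) : M.entranceFee i < 0 ↔ M.excess M.optCost i < 0 := by
  rw [entranceFee_eq, div_lt_iff₀ M.totalRate_pos, zero_mul]

theorem admissible_lookAhead {α : ℝ} (h1 : M.stockoutRate M.full ≤ α) (h2 : α < M.maxRate) :
    M.Admissible (M.lookAhead α) := by
  refine admissible_of_emptyStates_subset (fun i hi => ?_) ?_
  · have : M.stockoutRate i = M.maxRate :=
      Finset.sum_congr rfl fun j _ => by rw [poissonTail_of_nonpos _ (hi j), mul_one]
    exact sub_pos.2 (this ▸ h2)
  · exact fun h => (sub_pos.1 h).not_ge h1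

theorem occupation_lookAhead_le (α : ℝ) (hU : M.Admissible U)
    (hα : M.Admissible (M.lookAhead α)) :
    M.occupation (M.lookAhead α) (M.excess α) ≤ M.occupation U (M.excess α) :=
  (hα.summable_indicator (abs_excess_le α)).tsum_le_tsum (fun l => cycleMean_lookAhead_le α l)
    (hU.summable_indicator (abs_excess_le α))

theorem admissible_lookAhead_optCost (hmin : M.minFixedCost ≤ M.A)
    (hmax : M.A < ∑ j, M.b j * (M.Q j : ℝ)) : M.Admissible (M.lookAhead M.optCost) :=
  admissible_lookAhead (stockoutRate_full_le_optCost hmin) (optCost_lt_maxRate hmin hmax)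

/-- The cycles of almost optimal trigger sets have bounded duration. -/
theorem Admissible.cycleTime_mul_le (hU : M.Admissible U) :
    (M.maxRate - M.avgCost U) * M.cycleTime U ≤ ∑ j, M.b j * (M.Q j : ℝ) - M.A := by
  have h := hU.le_cycleCost_sub
  have h2 : M.avgCost U * M.cycleTime U = M.cycleCost U := by
    rw [hU.avgCost_eq, div_mul_cancel₀ _ hU.cycleTime_pos.ne']
  linarith

/-- Were the rule worse than α*, its excess cost c over one cycle would bound that of every
admissible V from below. Nearly optimal V have bounded cycle times, so their excess cost per cycle
is arbitrarily small, a contradiction. -/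
theorem avgCost_lookAhead (hmin : M.minFixedCost ≤ M.A)
    (hmax : M.A < ∑ j, M.b j * (M.Q j : ℝ)) :
    M.avgCost (M.lookAhead M.optCost) = M.optCost := by
  have hA := admissible_lookAhead_optCost hmin hmax
  have hlt := optCost_lt_maxRate hmin hmax
  refine le_antisymm ?_ (optCost_le hmin hA)
  have hmul : ∀ V, M.Admissible V → M.avgCost V * M.cycleTime V = M.cycleCost V := fun V hV => by
    rw [hV.avgCost_eq, div_mul_cancel₀ _ hV.cycleTime_pos.ne']
  by_contra hcon
  have hcon' : 0 < M.avgCost (M.lookAhead M.optCost) - M.optCost := by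
    rw [sub_pos]
    exact not_le.1 hcon
  set c := (M.avgCost (M.lookAhead M.optCost) - M.optCost) * M.cycleTime (M.lookAhead M.optCost)
    with hc
  have hcpos : 0 < c := mul_pos hcon' hA.cycleTime_pos
  set d := M.maxRate - M.optCost with hd
  have hdpos : 0 < d := sub_pos.2 hlt
  set s := ∑ j, M.b j * (M.Q j : ℝ) - M.A with hs
  have hspos : 0 < s := sub_pos.2 hmax
  have hlow : ∀ V, M.Admissible V → c ≤ (M.avgCost V - M.optCost) * M.cycleTime V := by
    intro V hV
    have h1 := hV.cycleCost_sub M.optCost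
    have h2 := hA.cycleCost_sub M.optCost
    have h3 := div_le_div_of_nonneg_right (occupation_lookAhead_le M.optCost hV hA)
      M.totalRate_pos.le
    rw [hc, sub_mul, sub_mul, hmul _ hV, hmul _ hA]
    linarith
  -- The bound d/2 forces a cycle time of at most 2s/d; the bound cd/(2s) then makes the excess cost
  -- per cycle smaller than c.
  obtain ⟨_, ⟨V, hV, rfl⟩, hVlt⟩ : ∃ a ∈ M.avgCost '' {U | M.Admissible U},
      a < M.optCost + min (d / 2) (c * d / (2 * s)) :=
    exists_lt_of_csInf_lt ⟨_, _, admissible_emptyStates, rfl⟩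
      (lt_add_of_pos_right _ (lt_min (by positivity) (by positivity)))
  have hV : M.Admissible V := hV
  have ht := hV.cycleTime_pos
  have h1 : M.avgCost V - M.optCost < d / 2 := by linarith [min_le_left (d / 2) (c * d / (2 * s))]
  have h2 : M.avgCost V - M.optCost < c * d / (2 * s) := by
    linarith [min_le_right (d / 2) (c * d / (2 * s))]
  have h3 : d / 2 * M.cycleTime V ≤ s := by
    refine le_trans (mul_le_mul_of_nonneg_right ?_ ht.le) hV.cycleTime_mul_le
    linarith
  have h4 := hlow V hV
  have h5 : (M.avgCost V - M.optCost) * M.cycleTime V < c * d / (2 * s) * M.cycleTime V :=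
    mul_lt_mul_of_pos_right h2 ht
  have h6 : c * d / (2 * s) * M.cycleTime V = c / s * (d / 2 * M.cycleTime V) := by
    field_simp
  have h7 : c / s * (d / 2 * M.cycleTime V) ≤ c / s * s :=
    mul_le_mul_of_nonneg_left h3 (by positivity)
  rw [div_mul_cancel₀ _ hspos.ne'] at h7
  linarith

/-- An optimal trigger set loses nothing against the one-step look-ahead rule. -/
theorem IsOptimal.cycleMean_eq (hmin : M.minFixedCost ≤ M.A)
    (hmax : M.A < ∑ j, M.b j * (M.Q j : ℝ)) (hU : M.IsOptimal U) (l : ℕ) :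
    M.cycleMean U l (Uᶜ.indicator (M.excess M.optCost)) =
      M.cycleMean (M.lookAhead M.optCost) l
        ((M.lookAhead M.optCost)ᶜ.indicator (M.excess M.optCost)) := by
  have hA := admissible_lookAhead_optCost hmin hmax
  have hval : ∀ V, M.Admissible V → M.avgCost V = M.optCost →
      M.cycleCost V - M.optCost * M.cycleTime V = 0 := fun V hV h => by
    rw [← h, hV.avgCost_eq, div_mul_cancel₀ _ hV.cycleTime_pos.ne', sub_self]
  have hUopt : M.avgCost U = M.optCost :=
    le_antisymm ((hU.2 _ hA).trans_eq (avgCost_lookAhead hmin hmax)) (optCost_le hmin hU.1)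
  have h1 := hval U hU.1 hUopt
  have h2 := hval _ hA (avgCost_lookAhead hmin hmax)
  rw [hU.1.cycleCost_sub] at h1
  rw [hA.cycleCost_sub] at h2
  have h3 : M.occupation (M.lookAhead M.optCost) (M.excess M.optCost) =
      M.occupation U (M.excess M.optCost) := by
    have h4 : M.occupation (M.lookAhead M.optCost) (M.excess M.optCost) / M.totalRate =
      M.occupation U (M.excess M.optCost) / M.totalRate := by linarith
    exact (div_left_inj' M.totalRate_pos.ne').1 h4
  by_contra hne
  -- The two series have equal sums and are ordered term by term, so no single term can differ.
  exact h3.not_lt (Summable.tsum_lt_tsum (fun k => cycleMean_lookAhead_le M.optCost k)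
    (lt_of_le_of_ne (cycleMean_lookAhead_le M.optCost l) (Ne.symm hne))
    (hA.summable_indicator (abs_excess_le _)) (hU.1.summable_indicator (abs_excess_le _)))

/-- By the renewal decomposition, a state visited at some time is visited at some position l of a
cycle, where the termwise comparison applies. -/
theorem exists_cycleMean_pos {i : M.State} {k : ℕ} (hi : i ∈ (M.law U k).support) :
    ∃ l, 0 < M.cycleMean U l (({i} : Set M.State).indicator 1) := by
  have hm : (M.law U k).mean (({i} : Set M.State).indicator 1) = ((M.law U k) i).toReal := by
    rw [PMF.mean, tsum_eq_single i]
    · simp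
    · intro j hj
      simp [hj]
  have hpos : 0 < ((M.law U k) i).toReal :=
    ENNReal.toReal_pos ((PMF.mem_support_iff _ _).1 hi) (PMF.apply_ne_top _ _)
  rw [← hm, law_mean_eq_sum] at hpos
  by_contra h
  push Not at h
  exact hpos.not_ge (Finset.sum_nonpos fun l _ =>
    mul_nonpos_of_nonneg_of_nonpos (renewalProb_nonneg U _) (h l))

end VendingModel

end

theorem corollary1 {J : ℕ} [NeZero J] (M : VendingModel J)
    (hmin : M.minFixedCost ≤ M.A) (hmax : M.A < ∑ j, M.b j * (M.Q j : ℝ)) :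
    -- the trigger set `{f' > 0}`, whose continue set is `{f' ≤ 0}`, is optimal
    (∃ U : Set M.State, M.IsOptimal U ∧
      Uᶜ = {i | M.entranceFee i ≤ 0} ∧ U = {i | 0 < M.entranceFee i} ∧
      Tendsto (M.avgCostUpTo U) atTop (𝓝 M.optCost)) ∧
    -- any optimal trigger set agrees with it on all visited states, up to ties `f' = 0`
    (∀ U : Set M.State, M.IsOptimal U → ∀ i : M.State, (∃ k, i ∈ (M.law U k).support) →
      (M.entranceFee i < 0 → i ∈ Uᶜ) ∧ (0 < M.entranceFee i → i ∈ U)) := by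
  have hA := VendingModel.admissible_lookAhead_optCost hmin hmax
  have hopt := VendingModel.avgCost_lookAhead hmin hmax
  have hset : M.lookAhead M.optCost = {i | 0 < M.entranceFee i} := by
    ext i
    exact (VendingModel.entranceFee_pos_iff i).symm
  refine ⟨⟨M.lookAhead M.optCost,
    ⟨hA, fun V hV => hopt.trans_le (VendingModel.optCost_le hmin hV)⟩, ?_, hset, ?_⟩, ?_⟩
  · rw [hset]
    ext i
    simp
  · have h := hA.tendsto_avgCostUpTo
    rwa [← hA.avgCost_eq, hopt] at h
  · rintro U hU i ⟨k, hk⟩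
    obtain ⟨l, hl⟩ := VendingModel.exists_cycleMean_pos hk
    -- For an optimal U the left side is zero, so the three nonnegative losses at position l all
    -- vanish. A visited state on the wrong side would make one of the first two strictly positive.
    have h := VendingModel.cycleMean_sub_lookAhead (U := U) M.optCost l
    rw [hU.cycleMean_eq hmin hmax, sub_self] at h
    have hp : (0 : M.State → ℝ) ≤ Uᶜ.indicator fun i => max (M.excess M.optCost i) 0 :=
      Set.indicator_nonneg fun i _ => VendingModel.excess_pos_part_nonneg M.optCost i
    have hn : (0 : M.State → ℝ) ≤ U.indicator fun i => max (-M.excess M.optCost i) 0 :=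
      Set.indicator_nonneg fun i _ => VendingModel.excess_neg_part_nonneg M.optCost i
    have h1 := VendingModel.cycleMean_nonneg (U := U) hp l
    have h2 := VendingModel.cycleMean_nonneg (U := U) hn l
    have h3 := VendingModel.cycleMean_mono_of_subset (Set.empty_subset U)
      (VendingModel.excess_neg_part_nonneg M.optCost)
      (le_refl (fun i => max (-M.excess M.optCost i) 0)) l
    refine ⟨fun hi hiU => ?_, fun hi => ?_⟩
    · rw [VendingModel.entranceFee_neg_iff] at hi
      have h4 := VendingModel.cycleMean_pos hl hn (by simpa [hiU] using hi)
      linarith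
    · rw [VendingModel.entranceFee_pos_iff] at hi
      by_contra hiU
      have h4 := VendingModel.cycleMean_pos hl hp (by simpa [hiU] using hi)
      linarith
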